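/- Theorem 2 (end-density limit). Consider the multilayer parking (particle deposition) system without screening on the three positions $-1,0,1$, with layers $1,2,3,\dots$. Particles arrive at the positions $-1,0,1$ according to three independent Poisson processes of rate $1$, and no particle ever arrives elsewhere. At time $0$ all sites $(x,r)$ are empty; a particle arriving at position $x$ is deposited at $(x,r)$, where $r\ge 1$ is the lowest layer in which $x$ and all positions at distance $1$ from $x$ are empty just before the arrival. Let $\kappa_t(x,r)\in\{0,1\}$ be the occupancy of the site $(x,r)$ at time $t$, and let $\rho_t(0,r)=\mathbb{E}\,\kappa_t(0,r)$ be the density of the center site at layer $r$. Then for every $r\ge 1$ the end-density $\rho^{(r)}=\lim_{t\to\infty}\rho_t(0,r)$ exists; the first layer has $\rho^{(1)}=\frac13$, whereas $$\lim_{r\to\infty}\rho^{(r)}=\frac12 .$$ -/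

import Mathlib

open MeasureTheory ProbabilityTheory Filter Topology
open scoped NNReal

/-- `N` is a Poisson process of rate `lam` on `[0, ∞)`: almost surely its paths start at `0`, are
nondecreasing and right-continuous; its increments are independent, and the increment over `(s, t]`
has the Poisson distribution with mean `lam * (t - s)`. -/
structure IsPoissonProcess {Ω : Type*} [MeasurableSpace Ω] (N : ℝ≥0 → Ω → ℕ) (lam : ℝ≥0)
    (P : Measure Ω) : Prop where
  measurable : ∀ t, Measurable (N t)
  start : ∀ᵐ ω ∂P, N 0 ω = 0
  mono : ∀ᵐ ω ∂P, Monotone fun t => N t ω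
  rightCont : ∀ᵐ ω ∂P, ∀ t, ContinuousWithinAt (fun u => N u ω) (Set.Ici t) t
  indepIncrements : HasIndepIncrements N P
  law_increment : ∀ s t, s ≤ t →
    HasLaw (fun ω => N t ω - N s ω) (poissonMeasure (lam * (t - s))) P

namespace Parking

/-- The three positions `-1, 0, 1` at which particles arrive. -/
abbrev Vertex : Type := ↥({-1, 0, 1} : Finset ℤ)

/-- A configuration: the set of occupied sites `(x, r)`, where `x` is a position and `r` a layer;
the layers are numbered `1, 2, 3, …`. -/
abbrev Config : Type := Set (ℤ × ℕ)

/-- The layer in which a particle arriving at position `x` is deposited: the lowest layer in which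
`x` and the positions at distance `1` from `x` are all empty (no screening: higher layers are
irrelevant). -/
noncomputable def depositLayer (η : Config) (x : ℤ) : ℕ :=
  sInf {r | 1 ≤ r ∧ ∀ y : ℤ, |y - x| ≤ 1 → (y, r) ∉ η}

/-- The configuration after one more particle has arrived at position `x`. -/
noncomputable def deposit (η : Config) (x : ℤ) : Config :=
  insert (x, depositLayer η x) η

/-- The configuration after the first `n` particles, when the particles arrive, in this order, at
the positions `a 0, a 1, a 2, …`; all sites are empty initially. -/
noncomputable def configAfter (a : ℕ → Vertex) : ℕ → Config
  | 0 => ∅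
  | n + 1 => deposit (configAfter a n) (a n)

/-- Total number of arrivals up to time `t`, where `c x t` is the number of arrivals at `x` up to
time `t`. -/
def total (c : Vertex → ℝ≥0 → ℕ) (t : ℝ≥0) : ℕ := ∑ x, c x t

/-- The time of arrival of particle number `n` (counted from `0`). -/
noncomputable def arrivalTime (c : Vertex → ℝ≥0 → ℕ) (n : ℕ) : ℝ≥0 :=
  sInf {t | n < total c t}

/-- Particle number `n` arrives at `x`: the counting path of `x` jumps at its time of arrival. -/
def ArrivesAt (c : Vertex → ℝ≥0 → ℕ) (n : ℕ) (x : Vertex) : Prop :=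
  ∀ s < arrivalTime c n, c x s < c x (arrivalTime c n)

open Classical in
/-- The position at which particle number `n` arrives. (For independent Poisson processes there is
almost surely exactly one such position; the other paths get an arbitrary value.) -/
noncomputable def arrivalVertex (c : Vertex → ℝ≥0 → ℕ) (n : ℕ) : Vertex :=
  if h : ∃ x, ArrivesAt c n x then h.choose else ⟨0, by decide⟩

/-- The configuration at time `t` when the arrivals are given by the counting paths `c`. -/
noncomputable def configAt (c : Vertex → ℝ≥0 → ℕ) (t : ℝ≥0) : Config :=
  configAfter (arrivalVertex c) (total c t)

open Classical in
/-- The occupancy at time `t` of the site `(x, r)`: it is `1` if there is a particle, `0`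
otherwise. -/
noncomputable def occupancy {Ω : Type*} (N : Vertex → ℝ≥0 → Ω → ℕ) (t : ℝ≥0) (x : ℤ) (r : ℕ)
    (ω : Ω) : ℝ :=
  if (x, r) ∈ configAt (fun v s => N v s ω) t then 1 else 0

/-- The density at time `t` of the site `(x, r)`: the expectation of its occupancy. -/
noncomputable def density {Ω : Type*} [MeasurableSpace Ω] (N : Vertex → ℝ≥0 → Ω → ℕ)
    (P : Measure Ω) (t : ℝ≥0) (x : ℤ) (r : ℕ) : ℝ :=
  ∫ ω, occupancy N t x r ω ∂P

end Parking

/-! Let the height be the highest layer in use. Up to it, every layer is blocked for the center and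
for one side, the leading one (`IsPile`). So a center or leading particle opens a new layer, while a
particle on the other side fills its lowest hole or, if there is none, opens a layer and takes the
lead. Hence the number d of holes is a Markov chain, and (0, r) ends up occupied iff the center
opens layer r.

With lag d, the center opens the next layer with probability 1/2 - 3^(-d)/6: center and leader
compete evenly unless the lag is used up first, which has probability 3^(-d) and leaves three equal
competitors. `deficit j d` is the mean of 3^(-D)/6, with D the lag after j openings from lag d. The
chain observed at openings has the invariant measure 1, 4, 4, …, of infinite mass, so the deficit
spreads out and vanishes: its total mass stays bounded (`deficit_mass_le`), yet its limit in j is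
the same for all d (`tendsto_deficit_zero`).

Given their number, the arrivals up to time T are independent uniform letters (`integral_arrivals`).
This is shown by cutting [0, T] into 2^m cells which, almost surely for large m, contain at most one
arrival each. Since the number of arrivals tends to infinity, dominated convergence reduces the
density to the limit of `centerProb`. -/

namespace Parking

/-! ### The lag recursion and its limit -/

/-- The probability that, starting from a configuration in which one of the sides lags behind by
`d` particles, the `(j + 1)`-st new layer is opened by a center particle within `k` arrivals. -/
noncomputable def centerProb : ℕ → ℕ → ℕ → ℝ
  | 0, _, _ => 0
  | _ + 1, 0, 0 => 1 / 3
  | k + 1, 0, d + 1 => (1 + centerProb k 0 d) / 3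
  | k + 1, j + 1, 0 => (centerProb k j 0 + 2 * centerProb k j 1) / 3
  | k + 1, j + 1, d + 1 =>
    (centerProb k j (d + 1) + centerProb k j (d + 2) + centerProb k (j + 1) d) / 3

/-- The amount by which the limit of `centerProb k j d` as `k → ∞` falls short of `1 / 2`. -/
noncomputable def deficit : ℕ → ℕ → ℝ
  | 0, d => (1 / 3) ^ d / 6
  | j + 1, 0 => (deficit j 0 + 2 * deficit j 1) / 3
  | j + 1, d + 1 => (deficit j (d + 1) + deficit j (d + 2) + deficit (j + 1) d) / 3

lemma deficit_zero_left (d : ℕ) : deficit 0 d = (1 / 3) ^ d / 6 := by rw [deficit]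

lemma deficit_succ_zero (j : ℕ) :
    deficit (j + 1) 0 = (deficit j 0 + 2 * deficit j 1) / 3 := by rw [deficit]

lemma deficit_succ_succ (j d : ℕ) : deficit (j + 1) (d + 1) =
    (deficit j (d + 1) + deficit j (d + 2) + deficit (j + 1) d) / 3 := by rw [deficit]

lemma tendsto_centerProb (j d : ℕ) :
    Tendsto (fun k => centerProb k j d) atTop (𝓝 (1 / 2 - deficit j d)) := by
  induction j generalizing d with
  | zero =>
    induction d with
    | zero =>
      -- Shifting k by one makes the first-step recursion applicable; the same shift is used in
      -- every case.
      rw [← tendsto_add_atTop_iff_nat 1, deficit_zero_left]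
      simp only [centerProb]
      norm_num
    | succ d ih =>
      rw [← tendsto_add_atTop_iff_nat 1]
      simp only [centerProb]
      have := (ih.const_add 1).div_const 3
      convert this using 2
      rw [deficit_zero_left, deficit_zero_left, pow_succ]
      ring
  | succ j ihj =>
    induction d with
    | zero =>
      rw [← tendsto_add_atTop_iff_nat 1]
      simp only [centerProb]
      convert ((ihj 0).add ((ihj 1).const_mul 2)).div_const 3 using 2
      rw [deficit_succ_zero]
      ring
    | succ d ih =>
      rw [← tendsto_add_atTop_iff_nat 1]
      simp only [centerProb]
      convert (((ihj (d + 1)).add (ihj (d + 2))).add ih).div_const 3 using 2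
      rw [deficit_succ_succ]
      ring

lemma deficit_nonneg (j d : ℕ) : 0 ≤ deficit j d := by
  induction j generalizing d with
  | zero => rw [deficit_zero_left]; positivity
  | succ j ihj =>
    induction d with
    | zero =>
      rw [deficit_succ_zero]
      linarith [ihj 0, ihj 1]
    | succ d ih =>
      rw [deficit_succ_succ]
      linarith [ihj (d + 1), ihj (d + 2)]

/-- A larger lag takes longer to use up. This order makes `deficit j 0` decrease in j, which gives
its limit. -/
lemma deficit_succ_right_le (j d : ℕ) : deficit j (d + 1) ≤ deficit j d := by
  induction j generalizing d with
  | zero =>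
    rw [deficit_zero_left, deficit_zero_left, pow_succ]
    have : (0 : ℝ) < (1 / 3) ^ d := by positivity
    linarith
  | succ j ihj =>
    induction d with
    | zero =>
      rw [deficit_succ_succ, deficit_succ_zero]
      linarith [ihj 0, ihj 1]
    | succ d ih =>
      rw [deficit_succ_succ] at ih
      rw [deficit_succ_succ j (d + 1), deficit_succ_succ]
      linarith [ihj (d + 1), ihj (d + 2)]

lemma deficit_succ_left_le (j : ℕ) : deficit (j + 1) 0 ≤ deficit j 0 := by
  rw [deficit_succ_zero]
  linarith [deficit_succ_right_le j 0]

/-- The measure with weights `1, 4, 4, …` is invariant, so that the total mass of the deficit does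
not grow. -/
lemma deficit_mass_le (j M : ℕ) :
    deficit j 0 + 4 * ∑ d ∈ Finset.range M, deficit j (d + 1) ≤ 1 / 2 := by
  induction j generalizing M with
  | zero =>
    have h : ∑ d ∈ Finset.range M, deficit 0 (d + 1) = (1 - (1 / 3) ^ M) / 12 := by
      induction M with
      | zero => simp
      | succ M ih =>
        rw [Finset.sum_range_succ, ih, deficit_zero_left, pow_succ]
        ring
    rw [h, deficit_zero_left]
    have : (0 : ℝ) < (1 / 3) ^ M := by positivity
    rw [pow_zero]
    linarith
  | succ j ih =>
    have h1 : ∑ d ∈ Finset.range M, deficit (j + 1) (d + 1) =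
        (∑ d ∈ Finset.range M, deficit j (d + 1) + ∑ d ∈ Finset.range M, deficit j (d + 2) +
          ∑ d ∈ Finset.range M, deficit (j + 1) d) / 3 := by
      rw [← Finset.sum_add_distrib, ← Finset.sum_add_distrib, Finset.sum_div]
      exact Finset.sum_congr rfl fun d _ => deficit_succ_succ j d
    have h2 := Finset.sum_range_succ' (fun d => deficit j (d + 1)) M
    have h3 := Finset.sum_range_succ (fun d => deficit j (d + 1)) M
    have h4 := Finset.sum_range_succ' (fun d => deficit (j + 1) d) M
    have h5 := Finset.sum_range_succ (fun d => deficit (j + 1) d) M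
    have h6 := deficit_nonneg j (M + 1)
    have h7 := deficit_nonneg (j + 1) M
    -- Truncating the sums leaves 2 * `deficit j (M + 1)` - 2 * `deficit (j + 1) M`; the bound with
    -- one more term absorbs the first, and the second has the right sign.
    have h8 := ih (M + 1)
    have h9 := deficit_succ_zero j
    simp only [zero_add, add_assoc, Nat.reduceAdd] at *
    linarith

lemma tendsto_deficit_zero : Tendsto (fun j => deficit j 0) atTop (𝓝 0) := by
  obtain ⟨c, hc⟩ : ∃ c, Tendsto (fun j => deficit j 0) atTop (𝓝 c) :=
    ⟨_, tendsto_atTop_ciInf (antitone_nat_of_succ_le deficit_succ_left_le)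
      ⟨0, by rintro _ ⟨j, rfl⟩; exact deficit_nonneg j 0⟩⟩
  have key : ∀ d, Tendsto (fun j => deficit j d) atTop (𝓝 c) ∧
      Tendsto (fun j => deficit j (d + 1)) atTop (𝓝 c) := by
    intro d
    induction d with
    | zero =>
      refine ⟨hc, ?_⟩
      -- The recursion at lag 0, solved for `deficit j 1`, has limit (3c - c) / 2 = c.
      have h := (((tendsto_add_atTop_iff_nat 1).2 hc).const_mul 3).sub hc |>.div_const 2
      convert h using 2 with j
      · rw [deficit_succ_zero]; ring
      · ring
    | succ d ih =>
      refine ⟨ih.2, ?_⟩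
      -- Solved for `deficit j (d + 2)`, the recursion has limit 3c - c - c = c.
      have h := ((((tendsto_add_atTop_iff_nat 1).2 ih.2).const_mul 3).sub ih.2).sub
        ((tendsto_add_atTop_iff_nat 1).2 ih.1)
      convert h using 2 with j
      · rw [deficit_succ_succ]; ring
      · ring
  have hc0 : 0 ≤ c := ge_of_tendsto' hc fun j => deficit_nonneg j 0
  have hle : ∀ M : ℕ, (M : ℝ) * c ≤ 1 := by
    intro M
    have h := tendsto_finsetSum (Finset.range M) fun d _ => (key d).2
    -- In the limit the mass bound reads (1 + 4M) c ≤ 1/2.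
    have h' := le_of_tendsto' (hc.add (h.const_mul 4)) fun j => deficit_mass_le j M
    simp only [Finset.sum_const, Finset.card_range, nsmul_eq_mul] at h'
    linarith
  have : c = 0 := by
    by_contra hne
    have hpos : 0 < c := lt_of_le_of_ne hc0 (Ne.symm hne)
    obtain ⟨M, hM⟩ := exists_nat_gt (1 / c)
    rw [div_lt_iff₀ hpos] at hM
    linarith [hle M]
  rwa [this] at hc

/-! ### Words of arrivals and the shape of the pile -/

/-- The average of `F` over all words of length `n`. -/
noncomputable def wordAvg : ℕ → (List Vertex → ℝ) → ℝ
  | 0, F => F []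
  | n + 1, F => (∑ x, wordAvg n fun w => F (x :: w)) / 3

/-- The configuration after particles have been added to `η` at the letters of the word `w`. -/
noncomputable def depositWord (η : Config) (w : List Vertex) : Config :=
  w.foldl (fun (η : Config) (x : Vertex) => deposit η x) η

open Classical in
/-- The indicator that the site `(0, r)` is occupied after depositing a word. -/
noncomputable def centerOccupied (r : ℕ) (η : Config) (w : List Vertex) : ℝ :=
  if (0, r) ∈ depositWord η w then 1 else 0

lemma configAfter_eq_depositWord (a : ℕ → Vertex) (n : ℕ) :
    configAfter a n = depositWord ∅ ((List.range n).map a) := by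
  induction n with
  | zero => rfl
  | succ n ih =>
    rw [configAfter, ih, depositWord, depositWord, List.range_succ, List.map_append,
      List.foldl_append]
    rfl

lemma sum_vertex (G : ℤ → ℝ) {σ : ℤ} (hσ : σ = 1 ∨ σ = -1) :
    ∑ x : Vertex, G x = G 0 + G σ + G (-σ) := by
  rw [Finset.sum_coe_sort ({-1, 0, 1} : Finset ℤ) G]
  rcases hσ with rfl | rfl <;> simp <;> ring

lemma wordAvg_centerOccupied_succ (k r : ℕ) (η : Config) {σ : ℤ} (hσ : σ = 1 ∨ σ = -1) :
    wordAvg (k + 1) (centerOccupied r η) =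
      (wordAvg k (centerOccupied r (deposit η 0)) + wordAvg k (centerOccupied r (deposit η σ)) +
        wordAvg k (centerOccupied r (deposit η (-σ)))) / 3 := by
  rw [wordAvg, ← sum_vertex (fun x => wordAvg k (centerOccupied r (deposit η x))) hσ]
  rfl

lemma depositLayer_eq {η : Config} {x : ℤ} {r : ℕ} (hr : 1 ≤ r)
    (hempty : ∀ y : ℤ, |y - x| ≤ 1 → (y, r) ∉ η)
    (hbelow : ∀ s, 1 ≤ s → s < r → ∃ y : ℤ, |y - x| ≤ 1 ∧ (y, s) ∈ η) :
    depositLayer η x = r := by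
  apply le_antisymm
  · exact Nat.sInf_le ⟨hr, hempty⟩
  · refine le_csInf ⟨r, hr, hempty⟩ ?_
    rintro s ⟨hs, hs'⟩
    by_contra hlt
    obtain ⟨y, hy, hmem⟩ := hbelow s hs (not_le.1 hlt)
    exact hs' y hy hmem

lemma center_mem_deposit_iff {η : Config} {x : ℤ} (hx : x ≠ 0) (r : ℕ) :
    (0, r) ∈ deposit η x ↔ (0, r) ∈ η := by
  simp [deposit, Prod.ext_iff, hx.symm]

/-- The layers up to `h` in which neither the center nor the side `-σ` is occupied. -/
def holes (η : Config) (h : ℕ) (σ : ℤ) : Set ℕ :=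
  {s | 1 ≤ s ∧ s ≤ h ∧ (0, s) ∉ η ∧ (-σ, s) ∉ η}

lemma finite_holes (η : Config) (h : ℕ) (σ : ℤ) : (holes η h σ).Finite :=
  (Set.finite_Iic h).subset fun _ hs => hs.2.1

/-- The configuration `η` has height `h`, the side `σ` leads (it is blocked in all layers up to
`h`), and the other side lags behind, with `d` open layers. -/
structure IsPile (η : Config) (h : ℕ) (σ : ℤ) (d : ℕ) : Prop where
  side : σ = 1 ∨ σ = -1
  bound : ∀ y s, (y, s) ∈ η → |y| ≤ 1 ∧ 1 ≤ s ∧ s ≤ h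
  cover : ∀ s, 1 ≤ s → s ≤ h → (0, s) ∈ η ∨ (σ, s) ∈ η
  card : (holes η h σ).ncard = d

lemma isPile_empty : IsPile ∅ 0 1 0 where
  side := Or.inl rfl
  bound := by simp
  cover := by intro s; omega
  card := by
    have : holes ∅ 0 1 = ∅ := by
      ext s
      simp only [holes, Set.mem_ofPred_eq, Set.mem_empty_iff_false, iff_false]
      omega
    rw [this, Set.ncard_empty]

namespace IsPile

variable {η : Config} {h d : ℕ} {σ : ℤ}

lemma abs_side (H : IsPile η h σ d) : |σ| = 1 := by
  rcases H.side with rfl | rfl <;> simp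

lemma side_ne_zero (H : IsPile η h σ d) : σ ≠ 0 := by
  rcases H.side with rfl | rfl <;> simp

lemma neg_side (H : IsPile η h σ d) : -σ = 1 ∨ -σ = -1 := by
  rcases H.side with rfl | rfl <;> simp

lemma notMem_of_lt (H : IsPile η h σ d) {y : ℤ} {s : ℕ} (hs : h < s) : (y, s) ∉ η :=
  fun hmem => by have := (H.bound y s hmem).2.2; omega

lemma depositLayer_center (H : IsPile η h σ d) : depositLayer η 0 = h + 1 := by
  refine depositLayer_eq (by omega) (fun y _ => H.notMem_of_lt (by omega)) fun s h1 h2 => ?_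
  rcases H.cover s h1 (by omega) with h3 | h3
  · exact ⟨0, by simp, h3⟩
  · exact ⟨σ, by simp [H.abs_side], h3⟩

lemma depositLayer_lead (H : IsPile η h σ d) : depositLayer η σ = h + 1 := by
  refine depositLayer_eq (by omega) (fun y _ => H.notMem_of_lt (by omega)) fun s h1 h2 => ?_
  rcases H.cover s h1 (by omega) with h3 | h3
  · exact ⟨0, by simp [H.abs_side], h3⟩
  · exact ⟨σ, by simp, h3⟩

lemma deposit_center (H : IsPile η h σ d) : IsPile (deposit η 0) (h + 1) σ d where
  side := H.side
  bound y s hmem := by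
    rw [deposit, H.depositLayer_center, Set.mem_insert_iff, Prod.mk.injEq] at hmem
    rcases hmem with ⟨rfl, rfl⟩ | hmem
    · simp
    · have := H.bound y s hmem
      exact ⟨this.1, this.2.1, by omega⟩
  cover s h1 h2 := by
    rw [deposit, H.depositLayer_center]
    by_cases hs : s = h + 1
    · left; simp [hs]
    · exact (H.cover s h1 (by omega)).imp (Set.mem_insert_of_mem _) (Set.mem_insert_of_mem _)
  card := by
    rw [← H.card]
    congr 1
    ext s
    have := H.side_ne_zero
    simp only [holes, deposit, H.depositLayer_center, Set.mem_insert_iff, Prod.mk.injEq,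
      Set.mem_ofPred_eq, true_and, not_or]
    constructor
    · rintro ⟨h1, h2, ⟨h3, h4⟩, h5, h6⟩
      exact ⟨h1, by omega, h4, h6⟩
    · rintro ⟨h1, h2, h3, h4⟩
      exact ⟨h1, by omega, ⟨by omega, h3⟩, by omega, h4⟩

lemma deposit_lead (H : IsPile η h σ d) : IsPile (deposit η σ) (h + 1) σ (d + 1) where
  side := H.side
  bound y s hmem := by
    rw [deposit, H.depositLayer_lead, Set.mem_insert_iff, Prod.mk.injEq] at hmem
    rcases hmem with ⟨rfl, rfl⟩ | hmem
    · exact ⟨H.abs_side.le, by omega, le_rfl⟩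
    · have := H.bound y s hmem
      exact ⟨this.1, this.2.1, by omega⟩
  cover s h1 h2 := by
    rw [deposit, H.depositLayer_lead]
    by_cases hs : s = h + 1
    · right; simp [hs]
    · exact (H.cover s h1 (by omega)).imp (Set.mem_insert_of_mem _) (Set.mem_insert_of_mem _)
  card := by
    have hins : holes (deposit η σ) (h + 1) σ = insert (h + 1) (holes η h σ) := by
      ext s
      have := H.side_ne_zero
      simp only [holes, deposit, H.depositLayer_lead, Set.mem_insert_iff, Prod.mk.injEq,
        Set.mem_ofPred_eq, not_or]
      constructor
      · rintro ⟨h1, h2, ⟨h3, h4⟩, h5, h6⟩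
        by_cases hs : s = h + 1
        · exact Or.inl hs
        · exact Or.inr ⟨h1, by omega, h4, h6⟩
      · rintro (rfl | ⟨h1, h2, h3, h4⟩)
        · exact ⟨by omega, le_rfl, ⟨by omega, H.notMem_of_lt (by omega)⟩, by omega,
            H.notMem_of_lt (by omega)⟩
        · exact ⟨h1, by omega, ⟨by omega, h3⟩, by omega, h4⟩
    rw [hins, Set.ncard_insert_of_notMem (fun hmem => by have := hmem.2.1; omega)
      (finite_holes η h σ), H.card]

/-- The sides do not see each other, so for the lagging side the open layers up to h are exactly the
holes, and the particle fills the lowest one. -/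
lemma deposit_lag (H : IsPile η h σ (d + 1)) : IsPile (deposit η (-σ)) h σ d := by
  classical
  have hne : (holes η h σ).Nonempty := by
    rw [Set.nonempty_iff_ne_empty]
    intro he
    have := H.card
    rw [he, Set.ncard_empty] at this
    omega
  have hmem := Nat.sInf_mem hne
  set m := sInf (holes η h σ) with hm
  have hlay : depositLayer η (-σ) = m := by
    refine depositLayer_eq hmem.1 (fun y hy hyη => ?_) fun s h1 h2 => ?_
    · have hb := (H.bound y m hyη).1
      have hy0 : y = 0 ∨ y = -σ := by
        rw [abs_le] at hy hb
        rcases H.side with rfl | rfl <;> omega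
      rcases hy0 with rfl | rfl
      · exact hmem.2.2.1 hyη
      · exact hmem.2.2.2 hyη
    · have hs : s ∉ holes η h σ := Nat.notMem_of_lt_sInf h2
      by_contra hcon
      push Not at hcon
      exact hs ⟨h1, h2.le.trans hmem.2.1, hcon 0 (by simp [H.abs_side]), hcon (-σ) (by simp)⟩
  refine ⟨H.side, fun y s hys => ?_, fun s h1 h2 => ?_, ?_⟩
  · rw [deposit, hlay, Set.mem_insert_iff, Prod.mk.injEq] at hys
    rcases hys with ⟨rfl, rfl⟩ | hys
    · exact ⟨by rw [abs_neg]; exact H.abs_side.le, hmem.1, hmem.2.1⟩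
    · exact H.bound y s hys
  · exact (H.cover s h1 h2).imp (Set.mem_insert_of_mem _) (Set.mem_insert_of_mem _)
  · have hdiff : holes (deposit η (-σ)) h σ = holes η h σ \ {m} := by
      ext s
      have := H.side_ne_zero
      simp only [holes, deposit, hlay, Set.mem_insert_iff, Prod.mk.injEq, Set.mem_ofPred_eq,
        not_or, true_and, Set.mem_sdiff, Set.mem_singleton_iff]
      constructor
      · rintro ⟨h1, h2, ⟨h3, h4⟩, h5, h6⟩
        exact ⟨⟨h1, h2, h4, h6⟩, h5⟩
      · rintro ⟨⟨h1, h2, h3, h4⟩, h5⟩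
        exact ⟨h1, h2, ⟨by omega, h3⟩, h5, h4⟩
    rw [hdiff, Set.ncard_sdiff_singleton_of_mem hmem, H.card]
    rfl

/-- Without holes both sides are blocked in all layers up to h, so either may count as the leader.
-/
lemma swap (H : IsPile η h σ 0) : IsPile η h (-σ) 0 where
  side := H.neg_side
  bound := H.bound
  cover s h1 h2 := by
    have he := (Set.ncard_eq_zero (finite_holes η h σ)).1 H.card
    have hs : s ∉ holes η h σ := by rw [he]; exact Set.notMem_empty s
    by_contra hcon
    push Not at hcon
    exact hs ⟨h1, h2, hcon.1, hcon.2⟩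
  card := by
    rw [Set.ncard_eq_zero (finite_holes _ _ _), Set.eq_empty_iff_forall_notMem]
    rintro s ⟨h1, h2, h3, h4⟩
    rw [neg_neg] at h4
    exact (H.cover s h1 h2).elim h3 h4

lemma exists_deposit_lag (H : IsPile η h σ d) :
    ∃ h' σ' d', h ≤ h' ∧ IsPile (deposit η (-σ)) h' σ' d' := by
  cases d with
  | zero => exact ⟨_, _, _, Nat.le_succ h, H.swap.deposit_lead⟩
  | succ d => exact ⟨_, _, _, le_rfl, H.deposit_lag⟩

lemma center_mem_deposit_center_iff (H : IsPile η h σ d) {r : ℕ} :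
    (0, r) ∈ deposit η 0 ↔ r = h + 1 ∨ (0, r) ∈ η := by
  simp [deposit, H.depositLayer_center]

/-- Center particles land only above the current height, which never decreases; so the center sites
up to h are frozen. -/
lemma wordAvg_centerOccupied_of_le (k : ℕ) {r : ℕ} (H : IsPile η h σ d) (hr : r ≤ h) :
    wordAvg k (centerOccupied r η) = centerOccupied r η [] := by
  induction k generalizing η h σ d with
  | zero => rfl
  | succ k ih =>
    rw [wordAvg_centerOccupied_succ k r η H.side]
    obtain ⟨h', σ', d', hle, H'⟩ := H.exists_deposit_lag
    rw [ih H.deposit_center (by omega), ih H.deposit_lead (by omega), ih H' (by omega)]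
    have hne := H.side_ne_zero
    have hcongr : ∀ η' : Config, ((0, r) ∈ η' ↔ (0, r) ∈ η) →
        centerOccupied r η' [] = centerOccupied r η [] := by
      intro η' h'
      classical
      unfold centerOccupied
      exact if_congr h' rfl rfl
    rw [hcongr _ (center_mem_deposit_iff hne r),
      hcongr _ (center_mem_deposit_iff (neg_ne_zero.2 hne) r),
      hcongr _ (H.center_mem_deposit_center_iff.trans (or_iff_right (by omega)))]
    ring

/-- Once layer `h + 1` has been opened, it is known whether its center is occupied. -/
lemma wordAvg_centerOccupied_deposit_center (k : ℕ) (H : IsPile η h σ d) :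
    wordAvg k (centerOccupied (h + 1) (deposit η 0)) = 1 := by
  rw [H.deposit_center.wordAvg_centerOccupied_of_le k le_rfl, centerOccupied, depositWord,
    List.foldl_nil, if_pos (H.center_mem_deposit_center_iff.2 (Or.inl rfl))]

lemma wordAvg_centerOccupied_deposit_lead (k : ℕ) (H : IsPile η h σ d) :
    wordAvg k (centerOccupied (h + 1) (deposit η σ)) = 0 := by
  rw [H.deposit_lead.wordAvg_centerOccupied_of_le k le_rfl, centerOccupied, depositWord,
    List.foldl_nil, if_neg]
  rw [center_mem_deposit_iff H.side_ne_zero]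
  exact H.notMem_of_lt (by omega)

/-- Conditioning on the first letter reproduces the clauses of `centerProb`: center and leader open
layer h + 1, a lagging particle does so only if d = 0. -/
lemma wordAvg_centerOccupied (k j : ℕ) (H : IsPile η h σ d) :
    wordAvg k (centerOccupied (h + 1 + j) η) = centerProb k j d := by
  induction k generalizing η h σ d j with
  | zero =>
    rw [wordAvg, centerProb, centerOccupied, depositWord, List.foldl_nil, if_neg]
    exact H.notMem_of_lt (by omega)
  | succ k ih =>
    rw [wordAvg_centerOccupied_succ k _ η H.side]
    cases j with
    | zero =>
      rw [add_zero, H.wordAvg_centerOccupied_deposit_center,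
        H.wordAvg_centerOccupied_deposit_lead]
      cases d with
      | zero =>
        rw [H.swap.wordAvg_centerOccupied_deposit_lead, centerProb]
        norm_num
      | succ d =>
        have := ih 0 H.deposit_lag
        rw [add_zero] at this
        rw [this, centerProb]
        ring
    | succ j =>
      have h1 : h + 1 + (j + 1) = h + 1 + 1 + j := by omega
      cases d with
      | zero =>
        rw [h1, ih j H.deposit_center, ih j H.deposit_lead, ih j H.swap.deposit_lead, centerProb]
        ring
      | succ d =>
        rw [ih (j + 1) H.deposit_lag, h1, ih j H.deposit_center, ih j H.deposit_lead, centerProb]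

end IsPile

/-! ### Reading the arrival order off cell increments -/

/-- The positions of the particles that have arrived up to time `t`, in order of arrival. -/
noncomputable def arrivals (c : Vertex → ℝ≥0 → ℕ) (t : ℝ≥0) : List Vertex :=
  (List.range (total c t)).map (arrivalVertex c)

@[simp]
lemma length_arrivals (c : Vertex → ℝ≥0 → ℕ) (t : ℝ≥0) :
    (arrivals c t).length = total c t := by
  simp [arrivals]

lemma configAt_eq_depositWord (c : Vertex → ℝ≥0 → ℕ) (t : ℝ≥0) :
    configAt c t = depositWord ∅ (arrivals c t) :=
  configAfter_eq_depositWord _ _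

/-- The increments of the counting paths over an interval in which nothing (`none`) or just one
particle at `x` (`some x`) arrives. -/
def cellCount : Option Vertex → Vertex → ℕ
  | none, _ => 0
  | some x, y => if x = y then 1 else 0

/-- The letters of a sequence of cells, without the empty cells. -/
def cellWord {n : ℕ} (v : Fin n → Option Vertex) : List Vertex := (List.ofFn v).reduceOption

lemma cellWord_consEquiv_none {n : ℕ} (v : Fin n → Option Vertex) :
    cellWord (Fin.consEquiv (fun _ => Option Vertex) (none, v)) = cellWord v := by
  simp [cellWord, List.ofFn_succ, Fin.consEquiv]

lemma cellWord_consEquiv_some {n : ℕ} (x : Vertex) (v : Fin n → Option Vertex) :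
    cellWord (Fin.consEquiv (fun _ => Option Vertex) (some x, v)) = x :: cellWord v := by
  simp [cellWord, List.ofFn_succ, Fin.consEquiv]

/-- Right-continuous, nondecreasing paths starting at `0`. -/
structure IsCountingFamily (c : Vertex → ℝ≥0 → ℕ) : Prop where
  start : ∀ x, c x 0 = 0
  mono : ∀ x, Monotone (c x)
  rightCont : ∀ x t, ContinuousWithinAt (c x) (Set.Ici t) t

/-- A right-continuous path with discrete values is constant just after the infimum, where points of
the superlevel set accumulate or which itself belongs to the set. -/
lemma sInf_superlevel_mem {f : ℝ≥0 → ℕ} (hf : ∀ t, ContinuousWithinAt f (Set.Ici t) t) {k : ℕ}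
    (hne : {t | k < f t}.Nonempty) : k < f (sInf {t | k < f t}) := by
  set τ := sInf {t | k < f t} with hτ
  have h1 : ∃ᶠ u in 𝓝 τ, u ∈ {t | k < f t} :=
    mem_closure_iff_frequently.1 (csInf_mem_closure hne (OrderBot.bddBelow _))
  have h2 : ∀ᶠ u in 𝓝[≥] τ, f u = f τ := by
    have := hf τ
    rw [ContinuousWithinAt, nhds_discrete, tendsto_pure] at this
    exact this
  rw [eventually_nhdsWithin_iff] at h2
  obtain ⟨u, hu, hu'⟩ := (h1.and_eventually h2).exists
  rw [← hu' (csInf_le (OrderBot.bddBelow _) hu)]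
  exact hu

namespace IsCountingFamily

variable {c : Vertex → ℝ≥0 → ℕ}

lemma total_mono (hc : IsCountingFamily c) : Monotone (total c) :=
  fun _ _ h => Finset.sum_le_sum fun x _ => hc.mono x h

lemma total_zero (hc : IsCountingFamily c) : total c 0 = 0 := by
  simp [total, hc.start]

lemma lt_total_arrivalTime (hc : IsCountingFamily c) {k : ℕ} {t : ℝ≥0} (ht : k < total c t) :
    k < total c (arrivalTime c k) := by
  refine sInf_superlevel_mem (f := total c) (fun t => ?_) ⟨t, ht⟩
  have := tendsto_finsetSum Finset.univ fun x (_ : x ∈ Finset.univ) => hc.rightCont x t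
  exact this

/-- Only the path at x jumps between s and t, so it alone can jump at the arrival time, which lies
in (s, t]. -/
lemma arrivalVertex_eq (hc : IsCountingFamily c) {s t : ℝ≥0} {x : Vertex}
    (h : ∀ y, c y t - c y s = cellCount (some x) y) : arrivalVertex c (total c s) = x := by
  have hx : c x t = c x s + 1 := by
    have := h x
    simp only [cellCount, if_true] at this
    omega
  have hst : s ≤ t := by
    by_contra hts
    have := hc.mono x (not_le.1 hts).le
    omega
  have hy : ∀ y, y ≠ x → c y t ≤ c y s := fun y hyx => by
    have := h y
    simp only [cellCount, hyx.symm, if_false] at this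
    omega
  have hlt : total c s < total c t :=
    Finset.sum_lt_sum (fun y _ => hc.mono y hst) ⟨x, Finset.mem_univ x, by omega⟩
  set τ := arrivalTime c (total c s) with hτ
  have hkτ : total c s < total c τ := hc.lt_total_arrivalTime hlt
  have hτt : τ ≤ t := csInf_le (OrderBot.bddBelow _) hlt
  have hsτ : s < τ := by
    by_contra hle
    exact absurd (hc.total_mono (not_lt.1 hle)) (not_le.2 hkτ)
  have hxτ : c x s < c x τ := by
    by_contra hle
    refine absurd (Finset.sum_le_sum fun y _ => ?_) (not_le.2 hkτ)
    by_cases hyx : y = x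
    · subst hyx; exact not_lt.1 hle
    · exact (hc.mono y hτt).trans (hy y hyx)
  have harr : ArrivesAt c (total c s) x := by
    intro u hu
    by_contra hle
    have hle : c x τ ≤ c x u := not_lt.1 hle
    have hsu : s ≤ u := by
      by_contra hus
      have := hc.mono x (not_le.1 hus).le
      omega
    have hlt' : total c s < total c u :=
      Finset.sum_lt_sum (fun y _ => hc.mono y hsu)
        ⟨x, Finset.mem_univ x, hxτ.trans_le hle⟩
    have hτu : τ ≤ u := csInf_le (OrderBot.bddBelow _) hlt'
    exact absurd hu (not_lt.2 hτu)
  have huniq : ∀ y, ArrivesAt c (total c s) y → y = x := by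
    intro y hay
    by_contra hyx
    have h1 : c y s < c y τ := hay s hsτ
    have h2 := hc.mono y hτt
    have h3 := hy y hyx
    omega
  have hex : ∃ y, ArrivesAt c (total c s) y := ⟨x, harr⟩
  rw [arrivalVertex, dif_pos hex]
  exact huniq _ hex.choose_spec

lemma arrivals_eq_append (hc : IsCountingFamily c) {s t : ℝ≥0} (hst : s ≤ t) {o : Option Vertex}
    (h : ∀ y, c y t - c y s = cellCount o y) : arrivals c t = arrivals c s ++ o.toList := by
  have htot : total c t = total c s + ∑ y, cellCount o y := by
    rw [total, total, ← Finset.sum_add_distrib]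
    refine Finset.sum_congr rfl fun y _ => ?_
    rw [← h y]
    have := hc.mono y hst
    omega
  cases o with
  | none =>
    simp only [cellCount, Finset.sum_const_zero, add_zero] at htot
    simp [arrivals, htot]
  | some x =>
    have hone : ∑ y, cellCount (some x) y = 1 := by
      simp only [cellCount, Finset.sum_ite_eq, Finset.mem_univ, if_true]
    rw [hone] at htot
    rw [arrivals, htot, List.range_succ, List.map_append, List.map_singleton,
      hc.arrivalVertex_eq h]
    rfl

lemma arrivals_eq_cellWord (hc : IsCountingFamily c) {t : ℕ → ℝ≥0} (ht : Monotone t)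
    (ht0 : t 0 = 0) {n : ℕ} (v : Fin n → Option Vertex)
    (h : ∀ i : Fin n, ∀ x, c x (t (i + 1)) - c x (t i) = cellCount (v i) x) :
    arrivals c (t n) = cellWord v := by
  induction n with
  | zero => simp [arrivals, ht0, hc.total_zero, cellWord]
  | succ n ih =>
    rw [hc.arrivals_eq_append (ht n.le_succ) (h (Fin.last n)),
      ih (fun i => v i.castSucc) fun i => h i.castSucc, cellWord, cellWord, List.ofFn_succ',
      List.reduceOption_concat]

end IsCountingFamily

/-! ### Cell weights and uniformity of the letters -/

lemma abs_wordAvg_le {C : ℝ} (n : ℕ) {F : List Vertex → ℝ} (hF : ∀ w, |F w| ≤ C) :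
    |wordAvg n F| ≤ C := by
  induction n generalizing F with
  | zero => exact hF []
  | succ n ih =>
    rw [wordAvg, abs_div, abs_of_pos (three_pos : (0 : ℝ) < 3), div_le_iff₀ three_pos]
    refine (Finset.abs_sum_le_sum_abs _ _).trans
      ((Finset.sum_le_card_nsmul _ _ C fun x _ => ih fun w => hF (x :: w)).trans_eq ?_)
    have hcard : (Finset.univ : Finset Vertex).card = 3 := by decide
    rw [hcard, nsmul_eq_mul, mul_comm]
    norm_num

/-- The probability that in a cell of length `δ` the increments are those of `o`. -/
noncomputable def cellWeight (δ : ℝ≥0) (o : Option Vertex) : ℝ :=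
  ∏ x, Real.exp (-δ) * δ ^ cellCount o x / (cellCount o x).factorial

lemma cellWeight_none (δ : ℝ≥0) : cellWeight δ none = Real.exp (-(3 * δ)) := by
  have hcard : (Finset.univ : Finset Vertex).card = 3 := by decide
  simp only [cellWeight, cellCount, pow_zero, mul_one, Nat.factorial_zero, Nat.cast_one, div_one,
    Finset.prod_const, hcard]
  rw [← Real.exp_nat_mul]
  congr 1
  push_cast
  ring

lemma cellWeight_some (δ : ℝ≥0) (x : Vertex) :
    cellWeight δ (some x) = δ * Real.exp (-(3 * δ)) := by
  have h : ∀ y, Real.exp (-δ) * (δ : ℝ) ^ cellCount (some x) y /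
      (cellCount (some x) y).factorial = Real.exp (-δ) * if x = y then (δ : ℝ) else 1 := by
    intro y
    by_cases hxy : x = y <;> simp [cellCount, hxy]
  have hcard : (Finset.univ : Finset Vertex).card = 3 := by decide
  rw [cellWeight, Finset.prod_congr rfl fun y _ => h y, Finset.prod_mul_distrib,
    Finset.prod_ite_eq, if_pos (Finset.mem_univ x), Finset.prod_const, hcard, ← Real.exp_nat_mul,
    mul_comm]
  congr 2
  push_cast
  ring

/-- The sum of `F` over the words of `n` cells of length `δ`, weighted with their probabilities. -/
noncomputable def cellSum (δ : ℝ≥0) (n : ℕ) (F : List Vertex → ℝ) : ℝ :=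
  ∑ v : Fin n → Option Vertex, (∏ i, cellWeight δ (v i)) * F (cellWord v)

lemma cellSum_succ (δ : ℝ≥0) (n : ℕ) (F : List Vertex → ℝ) :
    cellSum δ (n + 1) F = Real.exp (-(3 * δ)) *
      (cellSum δ n F + δ * ∑ x, cellSum δ n fun w => F (x :: w)) := by
  rw [cellSum, ← (Fin.consEquiv fun _ => Option Vertex).sum_comp, Fintype.sum_prod_type,
    Fintype.sum_option]
  simp only [Fin.consEquiv_apply, Fin.prod_univ_succ, Fin.cons_zero, Fin.cons_succ,
    cellWord_consEquiv_none, cellWord_consEquiv_some, cellWeight_none, cellWeight_some, mul_assoc,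
    ← Finset.mul_sum]
  rw [mul_add]
  simp only [cellSum]
  ring

lemma cellSum_sum_div {ι : Type*} (s : Finset ι) (δ : ℝ≥0) (n : ℕ) (a : ℝ)
    (F : ι → List Vertex → ℝ) :
    cellSum δ n (fun w => (∑ i ∈ s, F i w) / a) = (∑ i ∈ s, cellSum δ n (F i)) / a := by
  simp only [cellSum]
  rw [Finset.sum_comm, Finset.sum_div]
  refine Finset.sum_congr rfl fun v _ => ?_
  rw [← Finset.mul_sum, mul_div_assoc]

/-- Given their number, the letters are uniformly distributed. -/
lemma cellSum_wordAvg (δ : ℝ≥0) (n : ℕ) (F : List Vertex → ℝ) :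
    cellSum δ n (fun w => wordAvg w.length F) = cellSum δ n F := by
  induction n generalizing F with
  | zero => simp [cellSum, cellWord, wordAvg]
  | succ n ih =>
    have hcard : (Finset.univ : Finset Vertex).card = 3 := by decide
    rw [cellSum_succ, cellSum_succ, ih]
    simp only [List.length_cons, wordAvg]
    rw [cellSum_sum_div, Finset.sum_const, hcard, nsmul_eq_mul]
    simp only [ih]
    congr 3
    push_cast
    ring

lemma cellSum_one (δ : ℝ≥0) (n : ℕ) :
    cellSum δ n (fun _ => 1) = (Real.exp (-(3 * δ)) * (1 + 3 * δ)) ^ n := by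
  induction n with
  | zero => simp [cellSum]
  | succ n ih =>
    have hcard : (Finset.univ : Finset Vertex).card = 3 := by decide
    rw [cellSum_succ, Finset.sum_const, hcard, ih, nsmul_eq_mul, pow_succ]
    push_cast
    ring

lemma one_sub_le_cellSum_one (δ : ℝ≥0) (n : ℕ) :
    1 - n * (9 * (δ : ℝ) ^ 2) ≤ cellSum δ n (fun _ => 1) := by
  rw [cellSum_one]
  have hδ : (0 : ℝ) ≤ δ := δ.2
  set a : ℝ := Real.exp (-(3 * δ)) * (1 + 3 * δ) with ha
  -- From exp(-3δ) ≥ 1 - 3δ and (1 - 3δ)(1 + 3δ) = 1 - 9δ²; Bernoulli's inequality then handles the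
  -- power.
  have h1 : -(9 * (δ : ℝ) ^ 2) ≤ a - 1 := by
    have := Real.add_one_le_exp (-(3 * (δ : ℝ)))
    nlinarith
  have h2 : 0 ≤ a := by positivity
  have h3 := one_add_mul_le_pow (by linarith : -2 ≤ a - 1) n
  rw [add_sub_cancel] at h3
  have h4 : (0 : ℝ) ≤ n := n.cast_nonneg
  nlinarith [mul_le_mul_of_nonneg_left h1 h4]

/-! ### From cells to Poisson processes -/

section Counting

variable {Ω : Type*} {N : Vertex → ℝ≥0 → Ω → ℕ}

/-- The event that the increments over the cells `(t i, t (i + 1)]` are those of `v`. -/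
def cellEvent (N : Vertex → ℝ≥0 → Ω → ℕ) (t : ℕ → ℝ≥0) {n : ℕ} (v : Fin n → Option Vertex) :
    Set Ω :=
  {ω | ∀ x, ∀ i : Fin n, N x (t (i + 1)) ω - N x (t i) ω = cellCount (v i) x}

lemma cellCount_injective : Function.Injective cellCount := by
  intro o o' h
  cases o with
  | none =>
    cases o' with
    | none => rfl
    | some y => simpa [cellCount] using congrFun h y
  | some x =>
    have hx := congrFun h x
    cases o' with
    | none => simp [cellCount] at hx
    | some y =>
      by_contra hne
      have hyx : y ≠ x := fun e => hne (by rw [e])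
      simp [cellCount, hyx] at hx

lemma eq_of_mem_cellEvent {t : ℕ → ℝ≥0} {n : ℕ} {v v' : Fin n → Option Vertex} {ω : Ω}
    (h : ω ∈ cellEvent N t v) (h' : ω ∈ cellEvent N t v') : v = v' :=
  funext fun i => cellCount_injective (funext fun x => (h x i).symm.trans (h' x i))

/-- The value of `F` at the word of the cells, or `0` if some cell has several arrivals. -/
noncomputable def cellApprox (N : Vertex → ℝ≥0 → Ω → ℕ) (t : ℕ → ℝ≥0) (n : ℕ)
    (F : List Vertex → ℝ) (ω : Ω) : ℝ :=
  ∑ v : Fin n → Option Vertex, (cellEvent N t v).indicator (fun _ => F (cellWord v)) ω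

lemma cellApprox_of_mem {t : ℕ → ℝ≥0} {n : ℕ} {v : Fin n → Option Vertex} {ω : Ω}
    (h : ω ∈ cellEvent N t v) (F : List Vertex → ℝ) :
    cellApprox N t n F ω = F (cellWord v) := by
  rw [cellApprox, Finset.sum_eq_single v, Set.indicator_of_mem h]
  · intro v' _ hne
    exact Set.indicator_of_notMem (fun h' => hne (eq_of_mem_cellEvent h' h)) _
  · simp

lemma abs_cellApprox_le {C : ℝ} (hC : 0 ≤ C) {F : List Vertex → ℝ} (hF : ∀ w, |F w| ≤ C)
    (t : ℕ → ℝ≥0) (n : ℕ) (ω : Ω) : |cellApprox N t n F ω| ≤ C := by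
  by_cases h : ∃ v : Fin n → Option Vertex, ω ∈ cellEvent N t v
  · obtain ⟨v, hv⟩ := h
    rw [cellApprox_of_mem hv]
    exact hF _
  · push Not at h
    rw [cellApprox, Finset.sum_eq_zero fun v _ => Set.indicator_of_notMem (h v) _, abs_zero]
    exact hC

variable [MeasurableSpace Ω] {P : Measure Ω}

lemma measurableSet_cellEvent (hN : ∀ x t, Measurable (N x t)) (t : ℕ → ℝ≥0) {n : ℕ}
    (v : Fin n → Option Vertex) : MeasurableSet (cellEvent N t v) := by
  have : cellEvent N t v = ⋂ x, ⋂ i : Fin n,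
      (fun ω => N x (t (i + 1)) ω - N x (t i) ω) ⁻¹' {cellCount (v i) x} := by
    ext ω
    simp [cellEvent]
  rw [this]
  exact MeasurableSet.iInter fun x => MeasurableSet.iInter fun i =>
    ((hN x _).sub (hN x _)) (measurableSet_singleton _)

/-- Factor first over positions by independence of the processes, then over cells by independence of
increments. -/
lemma measureReal_cellEvent (hN : ∀ x, IsPoissonProcess (N x) 1 P)
    (hind : iIndepFun (fun x ω t => N x t ω) P) {t : ℕ → ℝ≥0} {δ : ℝ≥0}
    (ht : ∀ i, t (i + 1) = t i + δ) {n : ℕ} (v : Fin n → Option Vertex) :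
    P.real (cellEvent N t v) = ∏ i, cellWeight δ (v i) := by
  have hmono : Monotone t := monotone_nat_of_le_succ fun i => by rw [ht]; exact le_self_add
  set A : Vertex → Set Ω :=
    fun x => ⋂ i : Fin n, {ω | N x (t (i + 1)) ω - N x (t i) ω = cellCount (v i) x} with hA
  have h1 : cellEvent N t v = ⋂ x, A x := by
    ext ω
    simp [cellEvent, hA]
  have h2 : P (⋂ x, A x) = ∏ x, P (A x) := by
    refine hind.meas_iInter fun x =>
      ⟨⋂ i : Fin n, {f | f (t (i + 1)) - f (t i) = cellCount (v i) x}, ?_, ?_⟩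
    · refine MeasurableSet.iInter fun i => ?_
      have hf : Measurable fun f : ℝ≥0 → ℕ => f (t (i + 1)) - f (t i) :=
        (measurable_pi_apply _).sub (measurable_pi_apply _)
      exact hf (measurableSet_singleton (cellCount (v i) x))
    · ext ω
      simp [hA]
  have h3 : ∀ x, P (A x) =
      ∏ i : Fin n, P {ω | N x (t (i + 1)) ω - N x (t i) ω = cellCount (v i) x} := by
    intro x
    have hinc := ((hN x).indepIncrements.nat hmono).precomp (Fin.val_injective (n := n))
    exact hinc.meas_iInter fun i =>
      ⟨{cellCount (v i) x}, measurableSet_singleton _, rfl⟩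
  have h4 : ∀ x, ∀ i : Fin n,
      (P {ω | N x (t (i + 1)) ω - N x (t i) ω = cellCount (v i) x}).toReal =
        Real.exp (-δ) * δ ^ cellCount (v i) x / (cellCount (v i) x).factorial := by
    intro x i
    have hlaw := (hN x).law_increment (t i) (t (i + 1)) (hmono (Nat.le_succ _))
    rw [hlaw.measure_eq (p := fun k => k = cellCount (v i) x) (measurableSet_singleton _), ht,
      add_tsub_cancel_left, one_mul]
    exact poissonMeasure_real_singleton δ _
  rw [measureReal_def, h1, h2, ENNReal.toReal_prod]
  simp_rw [h3, ENNReal.toReal_prod, h4]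
  rw [Finset.prod_comm]
  rfl

lemma measurable_cellApprox (hN : ∀ x t, Measurable (N x t)) (t : ℕ → ℝ≥0) (n : ℕ)
    (F : List Vertex → ℝ) : Measurable (cellApprox N t n F) :=
  Finset.measurable_fun_sum _ fun v _ =>
    measurable_const.indicator (measurableSet_cellEvent hN t v)

lemma integral_cellApprox [IsProbabilityMeasure P] (hN : ∀ x, IsPoissonProcess (N x) 1 P)
    (hind : iIndepFun (fun x ω t => N x t ω) P) {t : ℕ → ℝ≥0} {δ : ℝ≥0}
    (ht : ∀ i, t (i + 1) = t i + δ) (n : ℕ) (F : List Vertex → ℝ) :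
    ∫ ω, cellApprox N t n F ω ∂P = cellSum δ n F := by
  have hm := measurableSet_cellEvent (N := N) (fun x => (hN x).measurable) t (n := n)
  unfold cellApprox
  rw [integral_finsetSum _ fun v _ => (integrable_const _).indicator (hm v)]
  refine Finset.sum_congr rfl fun v _ => ?_
  rw [integral_indicator_const _ (hm v), measureReal_cellEvent hN hind ht, smul_eq_mul]

lemma measure_compl_iUnion_cellEvent_le [IsProbabilityMeasure P]
    (hN : ∀ x, IsPoissonProcess (N x) 1 P)
    (hind : iIndepFun (fun x ω t => N x t ω) P) {t : ℕ → ℝ≥0} {δ : ℝ≥0}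
    (ht : ∀ i, t (i + 1) = t i + δ) (n : ℕ) :
    P (⋃ v : Fin n → Option Vertex, cellEvent N t v)ᶜ ≤ ENNReal.ofReal (n * (9 * (δ : ℝ) ^ 2)) := by
  have hm := measurableSet_cellEvent (N := N) (fun x => (hN x).measurable) t (n := n)
  have h1 : P.real (⋃ v : Fin n → Option Vertex, cellEvent N t v) = cellSum δ n fun _ => 1 := by
    rw [measureReal_iUnion_fintype
      (fun v v' hne => Set.disjoint_left.2 fun ω h h' => hne (eq_of_mem_cellEvent h h')) hm]
    exact Finset.sum_congr rfl fun v _ => by rw [measureReal_cellEvent hN hind ht, mul_one]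
  rw [← ofReal_measureReal, probReal_compl_eq_one_sub (MeasurableSet.iUnion hm), h1]
  exact ENNReal.ofReal_le_ofReal (by linarith [one_sub_le_cellSum_one δ n])

lemma ae_isCountingFamily (hN : ∀ x, IsPoissonProcess (N x) 1 P) :
    ∀ᵐ ω ∂P, IsCountingFamily fun x s => N x s ω := by
  filter_upwards [ae_all_iff.2 fun x => (hN x).start, ae_all_iff.2 fun x => (hN x).mono,
    ae_all_iff.2 fun x => (hN x).rightCont] with ω h1 h2 h3
  exact ⟨h1, h2, h3⟩

/-- The division points of `[0, T]` into `2 ^ m` cells. -/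
noncomputable def dyadicGrid (T : ℝ≥0) (m i : ℕ) : ℝ≥0 := i * (T / 2 ^ m)

lemma dyadicGrid_succ (T : ℝ≥0) (m i : ℕ) :
    dyadicGrid T m (i + 1) = dyadicGrid T m i + T / 2 ^ m := by
  simp only [dyadicGrid]
  push_cast
  ring

lemma dyadicGrid_two_pow (T : ℝ≥0) (m : ℕ) : dyadicGrid T m (2 ^ m) = T := by
  simp only [dyadicGrid]
  push_cast
  exact mul_div_cancel₀ T (by positivity)

/-- Some cell has several arrivals with probability at most 9T² / 2^m, which is summable;
Borel–Cantelli applies. -/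
lemma ae_eventually_cellApprox_eq [IsProbabilityMeasure P]
    (hN : ∀ x, IsPoissonProcess (N x) 1 P)
    (hind : iIndepFun (fun x ω t => N x t ω) P) (T : ℝ≥0) (F : List Vertex → ℝ) :
    ∀ᵐ ω ∂P, ∀ᶠ m in atTop,
      cellApprox N (dyadicGrid T m) (2 ^ m) F ω = F (arrivals (fun x s => N x s ω) T) := by
  have hbound : ∀ m : ℕ, P (⋃ v : Fin (2 ^ m) → Option Vertex, cellEvent N (dyadicGrid T m) v)ᶜ ≤
      ENNReal.ofReal (9 * (T : ℝ) ^ 2 * (1 / 2) ^ m) := by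
    intro m
    refine (measure_compl_iUnion_cellEvent_le hN hind (dyadicGrid_succ T m) _).trans_eq ?_
    congr 1
    push_cast
    have : (2 : ℝ) ^ m ≠ 0 := by positivity
    rw [one_div, inv_pow]
    field_simp
  have hsum : Summable fun m : ℕ => 9 * (T : ℝ) ^ 2 * (1 / 2) ^ m :=
    summable_geometric_two.mul_left _
  have hBC := ae_eventually_notMem (μ := P)
    (ne_top_of_le_ne_top hsum.tsum_ofReal_ne_top (ENNReal.tsum_le_tsum hbound))
  filter_upwards [hBC, ae_isCountingFamily hN] with ω h1 hc
  filter_upwards [h1] with m hm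
  rw [Set.notMem_compl_iff, Set.mem_iUnion] at hm
  obtain ⟨v, hv⟩ := hm
  have hmono : Monotone (dyadicGrid T m) :=
    monotone_nat_of_le_succ fun i => by rw [dyadicGrid_succ]; exact le_self_add
  rw [cellApprox_of_mem hv, ← hc.arrivals_eq_cellWord hmono (by simp [dyadicGrid]) v
    fun i x => hv x i, dyadicGrid_two_pow]

lemma aestronglyMeasurable_arrivals [IsProbabilityMeasure P]
    (hN : ∀ x, IsPoissonProcess (N x) 1 P)
    (hind : iIndepFun (fun x ω t => N x t ω) P) (T : ℝ≥0) (F : List Vertex → ℝ) :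
    AEStronglyMeasurable (fun ω => F (arrivals (fun x s => N x s ω) T)) P :=
  (aemeasurable_of_tendsto_metrizable_ae' (fun m =>
      (measurable_cellApprox (fun x => (hN x).measurable) (dyadicGrid T m) (2 ^ m) F).aemeasurable)
    ((ae_eventually_cellApprox_eq hN hind T F).mono fun _ h =>
      tendsto_const_nhds.congr' (h.mono fun _ h' => h'.symm))).aestronglyMeasurable

lemma tendsto_cellSum [IsProbabilityMeasure P] (hN : ∀ x, IsPoissonProcess (N x) 1 P)
    (hind : iIndepFun (fun x ω t => N x t ω) P) (T : ℝ≥0) {F : List Vertex → ℝ} {C : ℝ}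
    (hC : 0 ≤ C) (hF : ∀ w, |F w| ≤ C) :
    Tendsto (fun m : ℕ => cellSum (T / 2 ^ m) (2 ^ m) F) atTop
      (𝓝 (∫ ω, F (arrivals (fun x s => N x s ω) T) ∂P)) := by
  simp_rw [← fun m : ℕ => integral_cellApprox hN hind (dyadicGrid_succ T m) (2 ^ m) F]
  refine tendsto_integral_of_dominated_convergence (fun _ => C) (fun m =>
    (measurable_cellApprox (fun x => (hN x).measurable) _ _ F).aestronglyMeasurable)
    (integrable_const C) (fun m => ae_of_all _ fun ω => abs_cellApprox_le hC hF _ _ ω) ?_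
  exact (ae_eventually_cellApprox_eq hN hind T F).mono fun _ h =>
    tendsto_const_nhds.congr' (h.mono fun _ h' => h'.symm)

/-- Given the number of arrivals, their positions are independent and uniformly distributed. -/
lemma integral_arrivals [IsProbabilityMeasure P] (hN : ∀ x, IsPoissonProcess (N x) 1 P)
    (hind : iIndepFun (fun x ω t => N x t ω) P) (T : ℝ≥0) {F : List Vertex → ℝ} {C : ℝ}
    (hC : 0 ≤ C) (hF : ∀ w, |F w| ≤ C) :
    ∫ ω, F (arrivals (fun x s => N x s ω) T) ∂P =
      ∫ ω, wordAvg (total (fun x s => N x s ω) T) F ∂P := by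
  have h := tendsto_cellSum hN hind T hC fun w => abs_wordAvg_le w.length hF
  simp only [cellSum_wordAvg, length_arrivals] at h
  exact tendsto_nhds_unique (tendsto_cellSum hN hind T hC hF) h

/-! ### Letting time tend to infinity -/

lemma tendsto_poissonMeasure_Iic (k : ℕ) :
    Tendsto (fun n : ℕ => poissonMeasure n (Set.Iic k)) atTop (𝓝 0) := by
  have h1 : ∀ n : ℕ, poissonMeasure n (Set.Iic k) =
      ENNReal.ofReal (∑ i ∈ Finset.Iic k, (n : ℝ) ^ i * Real.exp (-n) / i.factorial) := by
    intro n
    rw [← ofReal_measureReal, ← Finset.coe_Iic, ← sum_measureReal_singleton]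
    congr 1
    refine Finset.sum_congr rfl fun i _ => ?_
    rw [poissonMeasure_real_singleton, mul_comm, NNReal.coe_natCast]
  have h2 : Tendsto (fun n : ℕ => ∑ i ∈ Finset.Iic k, (n : ℝ) ^ i * Real.exp (-n) / i.factorial)
      atTop (𝓝 0) := by
    rw [← Finset.sum_const_zero (s := Finset.Iic k)]
    refine tendsto_finsetSum _ fun i _ => ?_
    rw [← zero_div (i.factorial : ℝ)]
    exact ((Real.tendsto_pow_mul_exp_neg_atTop_nhds_zero i).comp
      tendsto_natCast_atTop_atTop).div_const _
  simp_rw [h1]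
  simpa using ENNReal.tendsto_ofReal h2

lemma ae_tendsto_total [IsProbabilityMeasure P] (hN : ∀ x, IsPoissonProcess (N x) 1 P) :
    ∀ᵐ ω ∂P, Tendsto (total fun x s => N x s ω) atTop atTop := by
  let o : Vertex := ⟨0, by decide⟩
  have h : ∀ k : ℕ, ∀ᵐ ω ∂P, ∃ n : ℕ, k < N o n ω - N o 0 ω := by
    intro k
    rw [ae_iff]
    refine le_antisymm (ge_of_tendsto' (tendsto_poissonMeasure_Iic k) fun n => ?_) zero_le
    have hlaw := (hN o).law_increment 0 n zero_le
    rw [tsub_zero, one_mul] at hlaw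
    refine le_trans ?_ (hlaw.measure_eq (p := fun i => i ∈ Set.Iic k) measurableSet_Iic).le
    refine measure_mono fun ω hω => ?_
    simp only [Set.mem_ofPred_eq, not_exists, not_lt] at hω
    exact hω n
  filter_upwards [ae_all_iff.2 h, ae_isCountingFamily hN] with ω h1 hc
  refine tendsto_atTop_atTop_of_monotone hc.total_mono fun k => ?_
  obtain ⟨n, hn⟩ := h1 k
  refine ⟨n, (hn.le.trans (Nat.sub_le _ _)).trans ?_⟩
  exact Finset.single_le_sum (f := fun x => N x n ω) (fun _ _ => zero_le) (Finset.mem_univ o)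

lemma tendsto_integral_wordAvg [IsProbabilityMeasure P] (hN : ∀ x, IsPoissonProcess (N x) 1 P)
    {F : List Vertex → ℝ} {C L : ℝ} (hF : ∀ w, |F w| ≤ C)
    (hL : Tendsto (fun n => wordAvg n F) atTop (𝓝 L)) :
    Tendsto (fun T => ∫ ω, wordAvg (total (fun x s => N x s ω) T) F ∂P) atTop (𝓝 L) := by
  have hconst : L = ∫ _, L ∂P := by simp
  rw [hconst]
  refine tendsto_integral_filter_of_dominated_convergence (fun _ => C)
    (Eventually.of_forall fun T => ?_)
    (Eventually.of_forall fun T => ae_of_all _ fun ω => abs_wordAvg_le _ hF) (integrable_const C)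
    ((ae_tendsto_total hN).mono fun ω h => hL.comp h)
  have hmeas : Measurable fun ω => total (fun x s => N x s ω) T :=
    Finset.measurable_fun_sum _ fun x _ => (hN x).measurable T
  exact ((measurable_of_countable fun n => wordAvg n F).comp hmeas).aestronglyMeasurable

end Counting

lemma occupancy_center_eq {Ω : Type*} (N : Vertex → ℝ≥0 → Ω → ℕ) (t : ℝ≥0) (r : ℕ) (ω : Ω) :
    occupancy N t 0 r ω = centerOccupied r ∅ (arrivals (fun x s => N x s ω) t) := by
  rw [occupancy, centerOccupied, configAt_eq_depositWord]

lemma abs_centerOccupied_le_one (r : ℕ) (η : Config) (w : List Vertex) :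
    |centerOccupied r η w| ≤ 1 := by
  unfold centerOccupied; split_ifs <;> norm_num

end Parking

theorem theorem2 {Ω : Type*} [MeasurableSpace Ω] (P : Measure Ω) [IsProbabilityMeasure P]
    (N : Parking.Vertex → ℝ≥0 → Ω → ℕ)
    (hN : ∀ x, IsPoissonProcess (N x) 1 P)
    (hind : iIndepFun (fun x ω t => N x t ω) P) :
    (∀ t r, Integrable (Parking.occupancy N t 0 r) P) ∧
    ∃ ρ : ℕ → ℝ,
      (∀ r, 1 ≤ r → Tendsto (fun t => Parking.density N P t 0 r) atTop (𝓝 (ρ r))) ∧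
      ρ 1 = 1 / 3 ∧
      Tendsto ρ atTop (𝓝 (1 / 2)) := by
  refine ⟨fun t r => ?_, fun r => 1 / 2 - Parking.deficit (r - 1) 0, fun r hr => ?_, ?_, ?_⟩
  · have h := Parking.aestronglyMeasurable_arrivals hN hind t (Parking.centerOccupied r ∅)
    simp_rw [← Parking.occupancy_center_eq] at h
    refine (integrable_const (1 : ℝ)).mono' h (ae_of_all _ fun ω => ?_)
    rw [Parking.occupancy_center_eq]
    exact Parking.abs_centerOccupied_le_one r ∅ _
  -- The empty pile has height 0 and lag 0, so layer 1 + j is opened after j others.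
  · obtain ⟨j, rfl⟩ := Nat.exists_eq_add_of_le hr
    have hbound := Parking.abs_centerOccupied_le_one (1 + j) ∅
    have hlim := Parking.tendsto_centerProb j 0
    simp_rw [← fun k => Parking.isPile_empty.wordAvg_centerOccupied k j, zero_add] at hlim
    simp only [Nat.add_sub_cancel_left]
    refine (Parking.tendsto_integral_wordAvg hN hbound hlim).congr fun t => ?_
    rw [Parking.density, ← Parking.integral_arrivals hN hind t zero_le_one hbound]
    simp_rw [Parking.occupancy_center_eq]
  · simp only [Nat.sub_self]
    rw [Parking.deficit_zero_left]
    norm_num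
  · have h := (Parking.tendsto_deficit_zero.comp (tendsto_sub_atTop_nat 1)).const_sub (1 / 2)
    rwa [sub_zero] at h
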